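/- For a positive integer $n$ let $\Omega_n$ be the graph whose vertices are the vectors in $\{1,-1\}^n$, with two vectors adjacent when they are orthogonal. For finite graphs $X,Y$ write $X \xrightarrow{q} Y$ if there are $d_A,d_B\in\mathbb{N}$, a unit vector $\psi\in\mathbb{C}^{d_A}\otimes\mathbb{C}^{d_B}$ and, for each $x\in V(X)$, positive semidefinite matrices $E_{xy}\in\mathbb{C}^{d_A\times d_A}$ and $F_{xy}\in\mathbb{C}^{d_B\times d_B}$ $(y\in V(Y))$ with $\sum_y E_{xy}=I$ and $\sum_y F_{xy}=I$, such that $\psi^*(E_{xy}\otimes F_{xy'})\psi=0$ for all $x$ and all $y\neq y'$, and $\psi^*(E_{xy}\otimes F_{x'y'})\psi=0$ whenever $x$ is adjacent to $x'$ in $X$ and $y$ is not adjacent to $y'$ in $Y$ (which includes the case $y=y'$). The quantum chromatic number of $X$ is $\chi_q(X)=\min\{c\in\mathbb{N} : X\xrightarrow{q}K_c\}$. If $n$ is a positive integer divisible by $4$, then $\chi_q(\Omega_n)=n$. -/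

import Mathlib

open scoped Matrix Kronecker ComplexOrder

/-- A family `E` of complex `d × d` matrices, indexed by a finite set of outcomes, is a
positive-operator valued measure: each `E y` is positive semidefinite (in particular Hermitian)
and they sum to the identity. -/
def IsPOVM {d : ℕ} {W : Type*} [Fintype W] (E : W → Matrix (Fin d) (Fin d) ℂ) : Prop :=
  (∀ y, (E y).PosSemidef) ∧ ∑ y, E y = 1

/-- A quantum strategy for a two-player game with questions in `V` and answers in `W`: a shared
unit vector `state` in `ℂ ^ dA ⊗ ℂ ^ dB` (with coordinates indexed by `Fin dA × Fin dB`), and for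
every question a POVM for Alice on `ℂ ^ dA` and a POVM for Bob on `ℂ ^ dB`, with outcomes the
possible answers. -/
structure QuantumStrategy (V W : Type*) [Fintype W] where
  /-- dimension of Alice's part -/
  dA : ℕ
  /-- dimension of Bob's part -/
  dB : ℕ
  /-- shared state -/
  state : EuclideanSpace ℂ (Fin dA × Fin dB)
  norm_state : ‖state‖ = 1
  /-- Alice's measurements -/
  alice : V → W → Matrix (Fin dA) (Fin dA) ℂ
  /-- Bob's measurements -/
  bob : V → W → Matrix (Fin dB) (Fin dB) ℂ
  alice_povm : ∀ x, IsPOVM (alice x)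
  bob_povm : ∀ x, IsPOVM (bob x)

/-- The probability `ψ* (E_{x y} ⊗ F_{x' y'}) ψ` that Alice answers `y` and Bob answers `y'` when
they are asked `x` and `x'` (a nonnegative real number, as an element of `ℂ`). -/
noncomputable def QuantumStrategy.prob {V W : Type*} [Fintype W] (S : QuantumStrategy V W)
    (x x' : V) (y y' : W) : ℂ :=
  star S.state.ofLp ⬝ᵥ ((S.alice x y ⊗ₖ S.bob x' y') *ᵥ S.state.ofLp)

/-- The strategy wins the `(X, Y)`-homomorphism game with certainty: for every pair of questions,
each losing pair of answers has probability zero. On equal questions the answers must be equal, and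
on adjacent questions they must be adjacent. -/
def QuantumStrategy.Wins {V W : Type*} [Fintype W] (S : QuantumStrategy V W)
    (X : SimpleGraph V) (Y : SimpleGraph W) : Prop :=
  (∀ x y y', y ≠ y' → S.prob x x y y' = 0) ∧
  (∀ x x' y y', X.Adj x x' → ¬ Y.Adj y y' → S.prob x x' y y' = 0)

/-- There is a quantum homomorphism from `X` to `Y`: some quantum strategy wins the
`(X, Y)`-homomorphism game. -/
def QuantumHom {V W : Type*} [Fintype W] (X : SimpleGraph V) (Y : SimpleGraph W) : Prop :=
  ∃ S : QuantumStrategy V W, S.Wins X Y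

/-- The quantum chromatic number: the least `c` such that there is a quantum homomorphism from `X`
to the complete graph on `c` vertices. -/
noncomputable def quantumChromaticNumber {V : Type*} [Fintype V] (X : SimpleGraph V) : ℕ :=
  sInf {c : ℕ | QuantumHom X (⊤ : SimpleGraph (Fin c))}

/-- The orthogonality graph `Ω_n`: the vertices are the `±1` vectors of length `n` (the elements
of `ℤˣ` are `1` and `-1`), and two distinct vectors are adjacent when they are orthogonal. The
condition `x ≠ y` only matters for `n = 0`, since `x ⬝ᵥ x = n`. -/
def orthogonalityGraph (n : ℕ) : SimpleGraph (Fin n → ℤˣ) where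
  Adj x y := x ≠ y ∧ (fun i => (x i : ℤ)) ⬝ᵥ (fun i => (y i : ℤ)) = 0
  symm := ⟨fun _ _ h => ⟨h.1.symm, by rw [dotProduct_comm]; exact h.2⟩⟩
  loopless := ⟨fun _ h => h.1 rfl⟩

/-! Lower bound: put `u x y = (E x y ⊗ 1) ψ`. Perfect consistency forces this to equal Bob's `(1 ⊗ F
x y) ψ` (`Wins.aliceVec_eq_bobVec`). Hence, for each colour `y`, the vectors `u x y` and `u x' y`
are orthogonal whenever `x`, `x'` are adjacent: a colour class is a vector-valued independent set.
The graph is a Cayley graph of the sign group, with the balanced vectors as connection set, so its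
eigenvalues are Krawtchouk values `K_s`. With degree `d = K_0`, every nontrivial eigenvalue is at
least `-d/(n-1)`. Hoffman's ratio bound for each colour, summed over colours and combined with
Cauchy-Schwarz, gives `n ≤ c`.

Upper bound: measure a maximally entangled state in the Fourier basis twisted by the sign vector.
The signs cancel on equal questions, and the unimodular Fourier entries cancel on equal answers. -/

/-! ### Fourier analysis on the group of sign vectors -/

/-- The character of the group of sign vectors attached to a set of coordinates. -/
def signChar {n : ℕ} (S : Finset (Fin n)) (x : Fin n → ℤˣ) : ℝ :=
  ∏ i ∈ S, ((x i : ℤ) : ℝ)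

theorem signChar_mul {n : ℕ} (S : Finset (Fin n)) (x y : Fin n → ℤˣ) :
    signChar S (x * y) = signChar S x * signChar S y := by
  simp [signChar, Finset.prod_mul_distrib]

theorem signChar_empty {n : ℕ} (x : Fin n → ℤˣ) : signChar ∅ x = 1 := by
  simp [signChar]

theorem sign_vector_mul_self {n : ℕ} (x : Fin n → ℤˣ) : x * x = 1 := by
  funext i
  simp [Int.units_mul_self]

theorem sign_vector_mul_mul_eq_one_iff {n : ℕ} (z x y : Fin n → ℤˣ) :
    z * (x * y) = 1 ↔ z = x * y := by
  constructor
  · intro h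
    calc z = z * ((x * y) * (x * y)) := by rw [sign_vector_mul_self, mul_one]
      _ = x * y := by rw [← mul_assoc, h, one_mul]
  · rintro rfl
    exact sign_vector_mul_self _

/-- Fourier inversion for the point mass at the identity. -/
theorem sum_signChar {n : ℕ} (w : Fin n → ℤˣ) :
    ∑ S : Finset (Fin n), signChar S w = if w = 1 then (2 : ℝ) ^ n else 0 := by
  have h : ∑ S : Finset (Fin n), signChar S w = ∏ i : Fin n, (1 + ((w i : ℤ) : ℝ)) := by
    rw [Finset.prod_one_add, Finset.powerset_univ]
    rfl
  rw [h]
  split_ifs with hw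
  · subst hw
    norm_num
  · obtain ⟨i, hi⟩ : ∃ i, w i ≠ 1 := by
      by_contra! hc
      exact hw (funext hc)
    have hi' : w i = -1 := (Int.units_eq_one_or (w i)).resolve_left hi
    exact Finset.prod_eq_zero (Finset.mem_univ i) (by simp [hi'])

/-- A convolution form on the group of sign vectors is diagonal in the Fourier basis. -/
theorem sum_signChar_mul_norm_sq {n : ℕ} {H : Type*} [NormedAddCommGroup H]
    [InnerProductSpace ℝ H] (a : (Fin n → ℤˣ) → ℝ) (f : (Fin n → ℤˣ) → H) :
    ∑ S : Finset (Fin n), (∑ z, a z * signChar S z) * ‖∑ x, signChar S x • f x‖ ^ 2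
      = 2 ^ n * ∑ x, ∑ y, a (x * y) * inner ℝ (f x) (f y) := by
  have h1 : ∀ S : Finset (Fin n),
      (∑ z, a z * signChar S z) * ‖∑ x, signChar S x • f x‖ ^ 2
        = ∑ x, ∑ y, ∑ z, a z * inner ℝ (f x) (f y) * signChar S (z * (x * y)) := by
    intro S
    rw [← real_inner_self_eq_norm_sq]
    simp_rw [sum_inner, inner_sum, real_inner_smul_left, real_inner_smul_right, signChar_mul,
      Finset.mul_sum, Finset.sum_mul]
    refine Finset.sum_congr rfl fun x _ => Finset.sum_congr rfl fun y _ =>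
      Finset.sum_congr rfl fun z _ => by ring
  simp_rw [h1]
  rw [Finset.sum_comm, Finset.mul_sum]
  refine Finset.sum_congr rfl fun x _ => ?_
  rw [Finset.sum_comm, Finset.mul_sum]
  refine Finset.sum_congr rfl fun y _ => ?_
  rw [Finset.sum_comm]
  -- Summing over characters first leaves only the term `z = x * y`.
  simp_rw [← Finset.mul_sum, sum_signChar, sign_vector_mul_mul_eq_one_iff]
  simp
  ring

/-- Parseval's identity on the group of sign vectors. -/
theorem sum_norm_sq_signChar {n : ℕ} {H : Type*} [NormedAddCommGroup H]
    [InnerProductSpace ℝ H] (f : (Fin n → ℤˣ) → H) :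
    ∑ S : Finset (Fin n), ‖∑ x, signChar S x • f x‖ ^ 2 = 2 ^ n * ∑ x, ‖f x‖ ^ 2 := by
  -- The point mass at the identity has all Fourier coefficients equal to 1.
  have h := sum_signChar_mul_norm_sq (fun z => if z = 1 then 1 else 0) f
  have h2 : ∀ x y : Fin n → ℤˣ, x * y = 1 ↔ y = x := by
    intro x y
    have := sign_vector_mul_mul_eq_one_iff x y 1
    rw [mul_one] at this
    rw [this, eq_comm]
  simp only [h2] at h
  simpa [signChar] using h

/-- The ratio bound for vector-valued functions on a Cayley graph of the group of sign vectors. -/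
theorem norm_sum_sq_le_of_signChar_bound {n : ℕ} {H : Type*} [NormedAddCommGroup H]
    [InnerProductSpace ℝ H] (a : (Fin n → ℤˣ) → ℝ) (f : (Fin n → ℤˣ) → H) (τ : ℝ)
    (ha : ∀ S : Finset (Fin n), S ≠ ∅ → -τ ≤ ∑ z, a z * signChar S z)
    (hf : ∀ x y, a (x * y) * inner ℝ (f x) (f y) = 0) :
    (∑ z, a z + τ) * ‖∑ x, f x‖ ^ 2 ≤ τ * (2 ^ n * ∑ x, ‖f x‖ ^ 2) := by
  have h0 := sum_signChar_mul_norm_sq a f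
  simp_rw [hf, Finset.sum_const_zero, mul_zero] at h0
  -- The quadratic form of `a` vanishes on `f`, so it can be added for free. Each character then has
  -- weight `τ` plus its eigenvalue, which is nonnegative except possibly at `∅`, and only the `∅`
  -- term is kept.
  rw [← sum_norm_sq_signChar, Finset.mul_sum, ← add_zero (∑ S : Finset (Fin n), _), ← h0,
    ← Finset.sum_add_distrib]
  have h1 : ∀ S : Finset (Fin n), 0 ≤ τ * ‖∑ x, signChar S x • f x‖ ^ 2 +
      (∑ z, a z * signChar S z) * ‖∑ x, signChar S x • f x‖ ^ 2 ∨ S = ∅ := by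
    intro S
    by_cases hS : S = ∅
    · exact Or.inr hS
    · left
      have := mul_nonneg (by linarith [ha S hS] : 0 ≤ τ + ∑ z, a z * signChar S z)
        (sq_nonneg ‖∑ x, signChar S x • f x‖)
      linarith
  conv_rhs => rw [← Finset.add_sum_erase _ _ (Finset.mem_univ ∅)]
  have h2 := Finset.sum_nonneg fun S (hS : S ∈ Finset.univ.erase (∅ : Finset (Fin n))) =>
    (h1 S).resolve_right (Finset.ne_of_mem_erase hS)
  simp only [signChar_empty, one_smul, mul_one]
  linarith

/-! ### Character sums over balanced sign vectors -/

/-- The indicator function of the sign vectors with coordinate sum zero. -/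
def balanced {n : ℕ} (z : Fin n → ℤˣ) : ℝ :=
  if ∑ i, (z i : ℤ) = 0 then 1 else 0

theorem balanced_nonneg {n : ℕ} (z : Fin n → ℤˣ) : 0 ≤ balanced z := by
  unfold balanced
  split_ifs <;> norm_num

theorem balanced_mul_sum {n : ℕ} (z : Fin n → ℤˣ) :
    balanced z * ∑ i, ((z i : ℤ) : ℝ) = 0 := by
  unfold balanced
  split_ifs with h
  · rw [one_mul]
    exact_mod_cast h
  · rw [zero_mul]

/-- The Fourier coefficients of the indicator function of balanced sign vectors. -/
noncomputable def balancedSum {n : ℕ} (S : Finset (Fin n)) : ℝ :=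
  ∑ z, balanced z * signChar S z

theorem balancedSum_map {n : ℕ} (σ : Equiv.Perm (Fin n)) (S : Finset (Fin n)) :
    balancedSum (S.map σ.toEmbedding) = balancedSum S := by
  unfold balancedSum
  refine Fintype.sum_equiv (σ.symm.arrowCongr (Equiv.refl _)) _ _ fun z => ?_
  have h1 : balanced ((σ.symm.arrowCongr (Equiv.refl ℤˣ)) z) = balanced z := by
    unfold balanced
    have : ∑ i, (((σ.symm.arrowCongr (Equiv.refl ℤˣ)) z i : ℤˣ) : ℤ) = ∑ i, (z i : ℤ) :=
      Equiv.sum_comp σ fun i => (z i : ℤ)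
    rw [this]
  rw [h1]
  simp [signChar, Finset.prod_map]

/-- Balancedness is invariant under permutations of the coordinates, and these act transitively on
the subsets of a given size. -/
theorem balancedSum_congr {n : ℕ} {S T : Finset (Fin n)} (h : S.card = T.card) :
    balancedSum S = balancedSum T := by
  let e : {x // x ∈ S} ≃ {x // x ∈ T} := Finset.equivOfCardEq h
  have hT : S.map e.extendSubtype.toEmbedding = T := by
    refine Finset.eq_of_subset_of_card_le (fun y hy => ?_) (by rw [Finset.card_map, h])
    obtain ⟨x, hx, rfl⟩ := Finset.mem_map.1 hy
    exact e.extendSubtype_mem x hx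
  rw [← hT, balancedSum_map]

/-- Multiply the character of `S` by the coordinate sum, which is zero on balanced vectors; each
factor `z i` removes `i` from `S` or adjoins it. -/
theorem balancedSum_recurrence {n : ℕ} (S : Finset (Fin n)) :
    ∑ i ∈ S, balancedSum (S.erase i) + ∑ i ∈ Sᶜ, balancedSum (insert i S) = 0 := by
  have h : ∑ i : Fin n, ∑ z, balanced z * (signChar S z * ((z i : ℤ) : ℝ)) = 0 := by
    rw [Finset.sum_comm]
    refine Finset.sum_eq_zero fun z _ => ?_
    have := balanced_mul_sum z
    rw [← Finset.mul_sum, ← Finset.mul_sum, mul_left_comm, this, mul_zero]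
  rw [← Finset.sum_add_sum_compl S] at h
  rw [← h]
  congr 1
  · refine Finset.sum_congr rfl fun i hi => Finset.sum_congr rfl fun z _ => ?_
    have hz : ((z i : ℤ) : ℝ) * ((z i : ℤ) : ℝ) = 1 := by
      rcases Int.units_eq_one_or (z i) with h | h <;> simp [h]
    rw [signChar, signChar, ← Finset.mul_prod_erase S _ hi]
    linear_combination (-(balanced z) * ∏ x ∈ S.erase i, ((z x : ℤ) : ℝ)) * hz
  · refine Finset.sum_congr rfl fun i hi => Finset.sum_congr rfl fun z _ => ?_
    rw [signChar, signChar, Finset.prod_insert (Finset.mem_compl.1 hi), mul_comm (((z i : ℤ) : ℝ))]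

/-- With `m` minus signs the sum is `s.card - 2m`, and `(-1)^m - 1 ≡ -2m` modulo 4. -/
theorem sign_sum_modEq_prod {n : ℕ} (z : Fin n → ℤˣ) (s : Finset (Fin n)) :
    ∑ i ∈ s, (z i : ℤ) ≡ s.card - 1 + ((∏ i ∈ s, z i : ℤˣ) : ℤ) [ZMOD 4] := by
  induction s using Finset.induction_on with
  | empty => simp
  | insert i s hi ih =>
    rw [Finset.sum_insert hi, Finset.prod_insert hi, Finset.card_insert_of_notMem hi]
    unfold Int.ModEq at *
    rcases Int.units_eq_one_or (z i) with h | h <;>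
      rcases Int.units_eq_one_or (∏ i ∈ s, z i) with h' | h' <;>
      simp only [h, h', mul_one, one_mul, neg_mul_neg, Units.val_one, Units.val_neg, Nat.cast_add,
        Nat.cast_one] at ih ⊢ <;> omega

theorem signChar_univ_of_balanced {n : ℕ} (h4 : 4 ∣ n) (z : Fin n → ℤˣ)
    (hz : ∑ i, (z i : ℤ) = 0) : signChar Finset.univ z = 1 := by
  have h := sign_sum_modEq_prod z Finset.univ
  rw [hz, Finset.card_univ, Fintype.card_fin] at h
  have h1 : ∏ i, z i = 1 := by
    rcases Int.units_eq_one_or (∏ i, z i) with h' | h'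
    · exact h'
    · rw [h', Int.ModEq, Units.val_neg, Units.val_one] at h
      omega
  have h2 : ∏ i, (z i : ℤ) = 1 := by
    rw [← Units.coe_prod, h1, Units.val_one]
  unfold signChar
  exact_mod_cast h2

/-- A balanced vector has product 1 when `4 ∣ n`, so complementary characters agree on it. This
reduces the eigenvalue bound to sets of size at most `n / 2`. -/
theorem balancedSum_compl {n : ℕ} (h4 : 4 ∣ n) (S : Finset (Fin n)) :
    balancedSum Sᶜ = balancedSum S := by
  refine Finset.sum_congr rfl fun z _ => ?_
  unfold balanced
  split_ifs with h
  · have h1 := signChar_univ_of_balanced h4 z h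
    rw [signChar, ← Finset.prod_mul_prod_compl S] at h1
    have h2 : signChar S z * signChar S z = 1 := by
      rw [← signChar_mul, sign_vector_mul_self]
      simp [signChar]
    change signChar S z * signChar Sᶜ z = 1 at h1
    linear_combination signChar S z * h1 - signChar Sᶜ z * h2
  · simp

/-- The value of `balancedSum` on sets with `s` elements. -/
noncomputable def krawtchouk (n s : ℕ) : ℝ :=
  balancedSum (Finset.univ.filter fun i : Fin n => i.val < s)

theorem balancedSum_eq_krawtchouk {n : ℕ} (S : Finset (Fin n)) :
    balancedSum S = krawtchouk n S.card := by
  refine balancedSum_congr ?_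
  have hS : S.card ≤ n := by simpa using S.card_le_univ
  rw [Fin.card_filter_val_lt, min_eq_right hS]

theorem krawtchouk_recurrence {n : ℕ} (S : Finset (Fin n)) :
    S.card * krawtchouk n (S.card - 1) + (n - S.card : ℕ) * krawtchouk n (S.card + 1) = 0 := by
  rw [← balancedSum_recurrence S, Finset.sum_congr rfl fun i hi => by
      rw [balancedSum_eq_krawtchouk, Finset.card_erase_of_mem hi],
    Finset.sum_congr (s₁ := Sᶜ) rfl fun i hi => by
      rw [balancedSum_eq_krawtchouk, Finset.card_insert_of_notMem (Finset.mem_compl.1 hi)]]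
  simp [Finset.card_compl]

theorem krawtchouk_one {n : ℕ} (hn : 0 < n) : krawtchouk n 1 = 0 := by
  have h := krawtchouk_recurrence (∅ : Finset (Fin n))
  have : (n : ℝ) ≠ 0 := by positivity
  simpa [hn.ne'] using h

theorem krawtchouk_add_two {n s : ℕ} (hs : s + 2 ≤ n) :
    (s + 1 : ℝ) * krawtchouk n s + (n - s - 1 : ℝ) * krawtchouk n (s + 2) = 0 := by
  have h := krawtchouk_recurrence (Finset.univ.filter fun i : Fin n => i.val < s + 1)
  rw [Fin.card_filter_val_lt, min_eq_right (by omega), Nat.cast_sub (by omega)] at h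
  push_cast at h
  rw [← h]
  ring

theorem krawtchouk_zero_nonneg (n : ℕ) : 0 ≤ krawtchouk n 0 := by
  refine Finset.sum_nonneg fun z _ => ?_
  simpa [signChar] using balanced_nonneg z

theorem krawtchouk_zero_pos {n : ℕ} (hn : Even n) : 0 < krawtchouk n 0 := by
  refine Finset.sum_pos' (fun z _ => by simpa [signChar] using balanced_nonneg z)
    -- The alternating vector is balanced for even `n`.
    ⟨fun i => (-1) ^ i.val, Finset.mem_univ _, ?_⟩
  have h : ∑ i : Fin n, ((((-1) ^ i.val : ℤˣ)) : ℤ) = 0 := by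
    simp only [Units.val_pow_eq_pow_val, Units.val_neg, Units.val_one]
    rw [Fin.sum_neg_one_pow, if_pos hn]
  rw [balanced, if_pos h]
  simp [signChar]

/-- The two-step recurrence gives equality at `s = 2`, and up to `n / 2` its ratio `(s + 1) / (n - s
- 1)` is at most 1, so absolute values do not increase. -/
theorem abs_krawtchouk_le {n : ℕ} (s : ℕ) (hs : 1 ≤ s) (hsn : 2 * s ≤ n) :
    (n - 1) * |krawtchouk n s| ≤ krawtchouk n 0 := by
  induction s using Nat.strong_induction_on with
  | _ s ih =>
    obtain rfl | rfl | hs3 : s = 1 ∨ s = 2 ∨ 3 ≤ s := by omega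
    · rw [krawtchouk_one (by omega), abs_zero, mul_zero]
      exact krawtchouk_zero_nonneg n
    · have h := krawtchouk_add_two (n := n) (s := 0) (by omega)
      have hn : (4 : ℝ) ≤ n := by exact_mod_cast hsn
      rw [← abs_of_nonneg (by linarith : (0 : ℝ) ≤ n - 1), ← abs_mul]
      have h' : ((n : ℝ) - 1) * krawtchouk n 2 = -krawtchouk n 0 := by
        push_cast at h
        linarith
      rw [h', abs_neg, abs_of_nonneg (krawtchouk_zero_nonneg n)]
    · obtain ⟨t, rfl⟩ : ∃ t, s = t + 2 := ⟨s - 2, by omega⟩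
      have h := krawtchouk_add_two (n := n) (s := t) (by omega)
      have hn : 2 * ((t : ℝ) + 2) ≤ n := by exact_mod_cast hsn
      have ht : (0 : ℝ) ≤ t := t.cast_nonneg
      have h1 : |((n : ℝ) - t - 1) * krawtchouk n (t + 2)| = |((t : ℝ) + 1) * krawtchouk n t| := by
        rw [← abs_neg (((t : ℝ) + 1) * _)]
        congr 1
        linarith
      rw [abs_mul, abs_mul, abs_of_nonneg (by linarith : (0 : ℝ) ≤ n - t - 1),
        abs_of_nonneg (by linarith : (0 : ℝ) ≤ t + 1)] at h1
      have h2 : |krawtchouk n (t + 2)| ≤ |krawtchouk n t| := by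
        have h3 : ((n : ℝ) - t - 1) * |krawtchouk n (t + 2)|
            ≤ (n - t - 1) * |krawtchouk n t| := by
          rw [h1]
          exact mul_le_mul_of_nonneg_right (by linarith) (abs_nonneg _)
        exact le_of_mul_le_mul_left h3 (by linarith)
      exact (mul_le_mul_of_nonneg_left h2 (by linarith)).trans
        (ih t (by omega) (by omega) (by omega))

/-- The least eigenvalue of the orthogonality graph. -/
theorem neg_krawtchouk_zero_le_balancedSum {n : ℕ} (h4 : 4 ∣ n) (S : Finset (Fin n))
    (hS : S ≠ ∅) : -(krawtchouk n 0 / (n - 1)) ≤ balancedSum S := by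
  have h1 : 1 ≤ S.card := Finset.card_pos.2 (Finset.nonempty_iff_ne_empty.2 hS)
  have hc : Sᶜ.card + S.card = n := by simp
  have hn : (4 : ℝ) ≤ n := by
    have : 4 ≤ n := Nat.le_of_dvd (by omega) h4
    exact_mod_cast this
  have key : ∀ T : Finset (Fin n), 1 ≤ T.card → 2 * T.card ≤ n →
      -(krawtchouk n 0 / (n - 1)) ≤ balancedSum T := by
    intro T hT hTn
    have h := abs_krawtchouk_le T.card hT hTn
    rw [balancedSum_eq_krawtchouk, neg_le, le_div_iff₀ (by linarith)]
    have := neg_abs_le (krawtchouk n T.card)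
    nlinarith
  by_cases h2 : 2 * S.card ≤ n
  · exact key S h1 h2
  · rw [← balancedSum_compl h4]
    by_cases h3 : Sᶜ = ∅
    -- The full set has eigenvalue `+d`, as its character is 1 on balanced vectors.
    · rw [h3, balancedSum_eq_krawtchouk, Finset.card_empty]
      have h0 := krawtchouk_zero_nonneg n
      have : 0 ≤ krawtchouk n 0 / (n - 1) := div_nonneg h0 (by linarith)
      linarith
    · exact key Sᶜ (Finset.card_pos.2 (Finset.nonempty_iff_ne_empty.2 h3)) (by omega)

/-! ### Vectors attached to a perfect strategy -/

theorem Matrix.PosSemidef.sub_mul_self {ι : Type*} [Fintype ι] [DecidableEq ι]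
    {M : Matrix ι ι ℂ} (hM : M.PosSemidef) (hM1 : (1 - M).PosSemidef) :
    (M - M * M).PosSemidef := by
  have h1 := hM1.conjTranspose_mul_mul_same M
  have h2 := hM.conjTranspose_mul_mul_same (1 - M)
  rw [hM.isHermitian.eq] at h1
  rw [hM1.isHermitian.eq] at h2
  have h := h1.add h2
  have e : M * (1 - M) * M + (1 - M) * M * (1 - M) = M - M * M := by noncomm_ring
  rwa [e] at h

theorem IsPOVM.one_sub {d : ℕ} {W : Type*} [Fintype W] {E : W → Matrix (Fin d) (Fin d) ℂ}
    (hE : IsPOVM E) (y : W) : (1 - E y).PosSemidef := by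
  classical
  rw [← hE.2, ← Finset.add_sum_erase _ _ (Finset.mem_univ y), add_sub_cancel_left]
  exact Matrix.posSemidef_sum _ fun i _ => hE.1 i

theorem star_mulVec_dotProduct_mulVec {ι : Type*} [Fintype ι] {M : Matrix ι ι ℂ}
    (hM : M.IsHermitian) (N : Matrix ι ι ℂ) (v : ι → ℂ) :
    star (M *ᵥ v) ⬝ᵥ (N *ᵥ v) = star v ⬝ᵥ ((M * N) *ᵥ v) := by
  rw [Matrix.star_mulVec, hM.eq, ← Matrix.dotProduct_mulVec, Matrix.mulVec_mulVec]

theorem EuclideanSpace.real_inner_eq_re_inner {ι : Type*} [Fintype ι] (v w : EuclideanSpace ℂ ι) :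
    inner ℝ v w = (inner ℂ v w).re := by
  simp [PiLp.inner_apply, Complex.inner]

namespace QuantumStrategy

variable {V W : Type*} [Fintype W]

/-- Alice's operator acting on the joint system. -/
def aliceOp (S : QuantumStrategy V W) (x : V) (y : W) :
    Matrix (Fin S.dA × Fin S.dB) (Fin S.dA × Fin S.dB) ℂ :=
  S.alice x y ⊗ₖ 1

/-- Bob's operator acting on the joint system. -/
def bobOp (S : QuantumStrategy V W) (x : V) (y : W) :
    Matrix (Fin S.dA × Fin S.dB) (Fin S.dA × Fin S.dB) ℂ :=
  1 ⊗ₖ S.bob x y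

/-- The (unnormalised) state after Alice answers `y` to the question `x`. -/
noncomputable def aliceVec (S : QuantumStrategy V W) (x : V) (y : W) :
    EuclideanSpace ℂ (Fin S.dA × Fin S.dB) :=
  WithLp.toLp 2 (S.aliceOp x y *ᵥ S.state.ofLp)

/-- The (unnormalised) state after Bob answers `y` to the question `x`. -/
noncomputable def bobVec (S : QuantumStrategy V W) (x : V) (y : W) :
    EuclideanSpace ℂ (Fin S.dA × Fin S.dB) :=
  WithLp.toLp 2 (S.bobOp x y *ᵥ S.state.ofLp)

variable (S : QuantumStrategy V W)

theorem aliceOp_posSemidef (x : V) (y : W) : (S.aliceOp x y).PosSemidef :=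
  ((S.alice_povm x).1 y).kronecker Matrix.PosSemidef.one

theorem bobOp_posSemidef (x : V) (y : W) : (S.bobOp x y).PosSemidef :=
  Matrix.PosSemidef.one.kronecker ((S.bob_povm x).1 y)

theorem one_sub_aliceOp_posSemidef (x : V) (y : W) : (1 - S.aliceOp x y).PosSemidef := by
  have h : 1 - S.aliceOp x y = (1 - S.alice x y) ⊗ₖ (1 : Matrix (Fin S.dB) (Fin S.dB) ℂ) := by
    rw [aliceOp, sub_eq_iff_eq_add, ← Matrix.add_kronecker, sub_add_cancel,
      Matrix.one_kronecker_one]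
  rw [h]
  exact ((S.alice_povm x).one_sub y).kronecker Matrix.PosSemidef.one

theorem one_sub_bobOp_posSemidef (x : V) (y : W) : (1 - S.bobOp x y).PosSemidef := by
  have h : 1 - S.bobOp x y = (1 : Matrix (Fin S.dA) (Fin S.dA) ℂ) ⊗ₖ (1 - S.bob x y) := by
    rw [bobOp, sub_eq_iff_eq_add, ← Matrix.kronecker_add, sub_add_cancel,
      Matrix.one_kronecker_one]
  rw [h]
  exact Matrix.PosSemidef.one.kronecker ((S.bob_povm x).one_sub y)

theorem sum_aliceVec (x : V) : ∑ y, S.aliceVec x y = S.state := by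
  have h : ∑ y, S.aliceOp x y = 1 := by
    have := congrArg (fun M => M ⊗ₖ (1 : Matrix (Fin S.dB) (Fin S.dB) ℂ)) (S.alice_povm x).2
    simp only [Matrix.one_kronecker_one] at this
    rw [← this]
    ext i j
    simp [aliceOp, Matrix.sum_apply, Finset.sum_mul]
  simp only [aliceVec]
  rw [← WithLp.toLp_sum, ← Matrix.sum_mulVec, h, Matrix.one_mulVec]

theorem sum_bobVec (x : V) : ∑ y, S.bobVec x y = S.state := by
  have h : ∑ y, S.bobOp x y = 1 := by
    have := congrArg (fun M => (1 : Matrix (Fin S.dA) (Fin S.dA) ℂ) ⊗ₖ M) (S.bob_povm x).2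
    simp only [Matrix.one_kronecker_one] at this
    rw [← this]
    ext i j
    simp [bobOp, Matrix.sum_apply, Finset.mul_sum]
  simp only [bobVec]
  rw [← WithLp.toLp_sum, ← Matrix.sum_mulVec, h, Matrix.one_mulVec]

theorem inner_aliceVec_bobVec (x x' : V) (y y' : W) :
    inner ℂ (S.aliceVec x y) (S.bobVec x' y') = S.prob x x' y y' := by
  rw [aliceVec, bobVec, EuclideanSpace.inner_toLp_toLp, dotProduct_comm,
    star_mulVec_dotProduct_mulVec (S.aliceOp_posSemidef x y).isHermitian, aliceOp, bobOp,
    ← Matrix.mul_kronecker_mul, mul_one, one_mul, prob]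

theorem inner_aliceVec_bobVec_eq_zero {x x' : V} {y y' : W} (h : S.prob x x' y y' = 0) :
    inner ℝ (S.aliceVec x y) (S.bobVec x' y') = 0 := by
  rw [EuclideanSpace.real_inner_eq_re_inner, inner_aliceVec_bobVec, h, Complex.zero_re]

theorem norm_sq_mulVec_le_inner {ι : Type*} [Fintype ι] [DecidableEq ι] {M : Matrix ι ι ℂ}
    (hM : M.PosSemidef) (hM1 : (1 - M).PosSemidef) (v : EuclideanSpace ℂ ι) :
    ‖WithLp.toLp 2 (M *ᵥ v.ofLp)‖ ^ 2 ≤ inner ℝ (WithLp.toLp 2 (M *ᵥ v.ofLp)) v := by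
  rw [← real_inner_self_eq_norm_sq, EuclideanSpace.real_inner_eq_re_inner,
    EuclideanSpace.real_inner_eq_re_inner,
    EuclideanSpace.inner_eq_star_dotProduct, EuclideanSpace.inner_eq_star_dotProduct,
    dotProduct_comm, dotProduct_comm v.ofLp]
  have h1 := star_mulVec_dotProduct_mulVec hM.isHermitian M v.ofLp
  have h2 := star_mulVec_dotProduct_mulVec hM.isHermitian 1 v.ofLp
  rw [mul_one, Matrix.one_mulVec] at h2
  have h3 := (hM.sub_mul_self hM1).re_dotProduct_nonneg v.ofLp
  rw [Matrix.sub_mulVec, dotProduct_sub, ← h1, ← h2, map_sub] at h3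
  exact sub_nonneg.1 h3

variable {S} {X : SimpleGraph V} {Y : SimpleGraph W}

/-- Since `0 ≤ M ≤ 1` gives `M² ≤ M`, each squared norm is at most the inner product with `ψ`.
Expanding `ψ` over the other player's outcomes leaves only `⟨a, b⟩`. Hence `‖a - b‖² ≤ 0`. -/
theorem Wins.aliceVec_eq_bobVec (hS : S.Wins X Y) (x : V) (y : W) :
    S.aliceVec x y = S.bobVec x y := by
  have h0 : ∀ y y' : W, y ≠ y' → inner ℝ (S.aliceVec x y) (S.bobVec x y') = 0 := by
    intro y y' hy
    exact S.inner_aliceVec_bobVec_eq_zero (hS.1 x y y' hy)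
  have ha : ‖S.aliceVec x y‖ ^ 2 ≤ inner ℝ (S.aliceVec x y) (S.bobVec x y) := by
    refine (norm_sq_mulVec_le_inner (S.aliceOp_posSemidef x y)
      (S.one_sub_aliceOp_posSemidef x y) S.state).trans_eq ?_
    change inner ℝ (S.aliceVec x y) S.state = _
    rw [← S.sum_bobVec x, inner_sum]
    exact Finset.sum_eq_single y (fun y' _ hy => h0 y y' hy.symm) (by simp)
  have hb : ‖S.bobVec x y‖ ^ 2 ≤ inner ℝ (S.aliceVec x y) (S.bobVec x y) := by
    refine (norm_sq_mulVec_le_inner (S.bobOp_posSemidef x y)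
      (S.one_sub_bobOp_posSemidef x y) S.state).trans_eq ?_
    change inner ℝ (S.bobVec x y) S.state = _
    rw [real_inner_comm, ← S.sum_aliceVec x, sum_inner]
    exact Finset.sum_eq_single y (fun y' _ hy => h0 y' y hy) (by simp)
  have h := norm_sub_sq_real (S.aliceVec x y) (S.bobVec x y)
  rw [← sub_eq_zero, ← norm_eq_zero]
  exact pow_eq_zero_iff two_ne_zero |>.1 (le_antisymm (by linarith) (sq_nonneg _))

theorem Wins.inner_aliceVec_eq_zero_of_ne (hS : S.Wins X Y) (x : V) {y y' : W} (hy : y ≠ y') :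
    inner ℝ (S.aliceVec x y) (S.aliceVec x y') = 0 := by
  rw [hS.aliceVec_eq_bobVec x y']
  exact S.inner_aliceVec_bobVec_eq_zero (hS.1 x y y' hy)

theorem Wins.inner_aliceVec_eq_zero_of_adj (hS : S.Wins X Y) {x x' : V} {y y' : W}
    (hx : X.Adj x x') (hy : ¬ Y.Adj y y') :
    inner ℝ (S.aliceVec x y) (S.aliceVec x' y') = 0 := by
  rw [hS.aliceVec_eq_bobVec x' y']
  exact S.inner_aliceVec_bobVec_eq_zero (hS.2 x x' y y' hx hy)

theorem Wins.sum_norm_sq_aliceVec (hS : S.Wins X Y) (x : V) :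
    ∑ y, ‖S.aliceVec x y‖ ^ 2 = 1 := by
  have h : inner ℝ S.state S.state = (1 : ℝ) := by
    rw [real_inner_self_eq_norm_sq, S.norm_state, one_pow]
  rw [← h, ← S.sum_aliceVec x, sum_inner]
  refine Finset.sum_congr rfl fun y _ => ?_
  rw [inner_sum, Finset.sum_eq_single y
    (fun y' _ hy => hS.inner_aliceVec_eq_zero_of_ne x hy.symm) (by simp),
    real_inner_self_eq_norm_sq]

end QuantumStrategy

/-! ### The lower bound -/

theorem norm_sum_sq_le_card_mul {ι H : Type*} [Fintype ι] [SeminormedAddCommGroup H] (f : ι → H) :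
    ‖∑ i, f i‖ ^ 2 ≤ Fintype.card ι * ∑ i, ‖f i‖ ^ 2 :=
  (pow_le_pow_left₀ (norm_nonneg _) (norm_sum_le _ _) 2).trans sq_sum_le_card_mul_sum_sq

theorem orthogonalityGraph_adj_of_balanced {n : ℕ} (hn : 0 < n) {x y : Fin n → ℤˣ}
    (h : ∑ i, ((x * y) i : ℤ) = 0) : (orthogonalityGraph n).Adj x y := by
  have h' : ∑ i, (x i : ℤ) * (y i : ℤ) = 0 := by simpa using h
  refine ⟨?_, h'⟩
  rintro rfl
  rw [sign_vector_mul_self] at h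
  simp at h
  omega

theorem le_of_quantumHom_top {n c : ℕ} (hn : 0 < n) (h4 : 4 ∣ n)
    (h : QuantumHom (orthogonalityGraph n) (⊤ : SimpleGraph (Fin c))) : n ≤ c := by
  obtain ⟨S, hS⟩ := h
  have hn4 : (4 : ℝ) ≤ n := by exact_mod_cast Nat.le_of_dvd hn h4
  set d := krawtchouk n 0 with hd
  have hd0 : 0 < d := krawtchouk_zero_pos (even_iff_two_dvd.2 (dvd_trans (by norm_num) h4))
  have hsum : ∑ z : Fin n → ℤˣ, balanced z = d := by
    rw [hd, ← Finset.card_empty (α := Fin n), ← balancedSum_eq_krawtchouk, balancedSum]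
    simp only [signChar_empty, mul_one]
  have hratio : ∀ y : Fin c, (d + d / (n - 1)) * ‖∑ x, S.aliceVec x y‖ ^ 2
      ≤ d / (n - 1) * (2 ^ n * ∑ x, ‖S.aliceVec x y‖ ^ 2) := by
    intro y
    rw [← hsum]
    refine norm_sum_sq_le_of_signChar_bound balanced (fun x => S.aliceVec x y) _
      (fun T hT => ?_) (fun x x' => ?_)
    · rw [hsum]
      exact neg_krawtchouk_zero_le_balancedSum h4 T hT
    · unfold balanced
      split_ifs with hb
      · rw [hS.inner_aliceVec_eq_zero_of_adj (orthogonalityGraph_adj_of_balanced hn hb) (by simp),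
          mul_zero]
      · rw [zero_mul]
  -- With `N = 2 ^ n` and `Q = ∑ y, ‖∑ x, u x y‖²`, this sum becomes `n Q ≤ N²`, while
  -- Cauchy-Schwarz over colours gives `N² ≤ c Q`, because all the vectors add up to `N ψ`.
  have htotal := Finset.sum_le_sum fun y (_ : y ∈ Finset.univ) => hratio y
  rw [← Finset.mul_sum, ← Finset.mul_sum, ← Finset.mul_sum, Finset.sum_comm] at htotal
  simp_rw [hS.sum_norm_sq_aliceVec] at htotal
  have hcs := norm_sum_sq_le_card_mul fun y => ∑ x, S.aliceVec x y
  rw [Finset.sum_comm] at hcs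
  simp_rw [S.sum_aliceVec] at hcs
  have hN : Fintype.card (Fin n → ℤˣ) = 2 ^ n := by simp
  rw [Finset.sum_const, Finset.card_univ, hN, nsmul_one] at htotal
  rw [Finset.sum_const, Finset.card_univ, hN, ← Nat.cast_smul_eq_nsmul ℝ, norm_smul, S.norm_state,
    mul_one, Fintype.card_fin] at hcs
  push_cast at htotal hcs
  rw [Real.norm_of_nonneg (by positivity)] at hcs
  set N : ℝ := 2 ^ n
  have hNpos : 0 < N := by positivity
  set Q := ∑ y, ‖∑ x, S.aliceVec x y‖ ^ 2
  have h1 : (n : ℝ) * Q ≤ N ^ 2 := by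
    have hn1 : (0 : ℝ) < n - 1 := by linarith
    have e : d + d / (n - 1) = d / (n - 1) * n := by
      field_simp
      ring
    rw [e, mul_assoc] at htotal
    have := le_of_mul_le_mul_left htotal (div_pos hd0 hn1)
    rwa [sq]
  have h2 : (n : ℝ) * N ^ 2 ≤ c * N ^ 2 :=
    calc (n : ℝ) * N ^ 2 ≤ n * (c * Q) := by gcongr
      _ = c * (n * Q) := by ring
      _ ≤ c * N ^ 2 := by gcongr
  exact_mod_cast le_of_mul_le_mul_right h2 (by positivity)

/-! ### The upper bound -/

/-- The Fourier matrix of `ℤ/n`, indexed by `Fin n`. -/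
noncomputable def fourierEntry (n : ℕ) [NeZero n] (j k : Fin n) : ℂ :=
  ZMod.stdAddChar (ZMod.finEquiv n j * ZMod.finEquiv n k)

theorem fourierEntry_comm {n : ℕ} [NeZero n] (j k : Fin n) :
    fourierEntry n j k = fourierEntry n k j := by
  rw [fourierEntry, fourierEntry, mul_comm]

theorem sum_fourierEntry_mul_star {n : ℕ} [NeZero n] (k l : Fin n) :
    ∑ j, fourierEntry n j k * star (fourierEntry n j l) = if k = l then (n : ℂ) else 0 := by
  have h : ∀ j : Fin n, fourierEntry n j k * star (fourierEntry n j l)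
      = ZMod.stdAddChar (ZMod.finEquiv n j * (ZMod.finEquiv n k - ZMod.finEquiv n l)) := by
    intro j
    rw [fourierEntry, fourierEntry, ← starRingEnd_apply, ← AddChar.map_neg_eq_conj,
      ← AddChar.map_add_eq_mul]
    congr 1
    ring
  simp_rw [h]
  rw [(ZMod.finEquiv n).bijective.sum_comp
      fun j => ZMod.stdAddChar (j * (ZMod.finEquiv n k - ZMod.finEquiv n l)),
    AddChar.sum_mulShift _ (ZMod.isPrimitive_stdAddChar n)]
  simp [sub_eq_zero]

/-- The vector of the `j`-th outcome of the Fourier measurement twisted by a sign vector. -/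
noncomputable def twistedFourier {n : ℕ} [NeZero n] (x : Fin n → ℤˣ) (j k : Fin n) : ℂ :=
  ((x k : ℤ) : ℂ) * fourierEntry n j k / (Real.sqrt n : ℂ)

theorem sqrt_mul_sqrt_complex (n : ℕ) : (Real.sqrt n : ℂ) * (Real.sqrt n : ℂ) = n := by
  rw [← Complex.ofReal_mul, Real.mul_self_sqrt n.cast_nonneg, Complex.ofReal_natCast]

theorem twistedFourier_mul_star {n : ℕ} [NeZero n] (x y : Fin n → ℤˣ) (i j k l : Fin n) :
    twistedFourier x i k * star (twistedFourier y j l)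
      = ((x k : ℤ) : ℂ) * ((y l : ℤ) : ℂ) *
        (fourierEntry n i k * star (fourierEntry n j l)) / n := by
  have h : star (twistedFourier y j l)
      = ((y l : ℤ) : ℂ) * star (fourierEntry n j l) / (Real.sqrt n : ℂ) := by
    simp only [twistedFourier, ← starRingEnd_apply, map_div₀, map_mul, map_intCast,
      Complex.conj_ofReal]
  rw [h, twistedFourier, div_mul_div_comm, sqrt_mul_sqrt_complex]
  ring

theorem sum_vecMulVec_twistedFourier {n : ℕ} [NeZero n] (x : Fin n → ℤˣ) :
    ∑ j, Matrix.vecMulVec (twistedFourier x j) (star (twistedFourier x j)) = 1 := by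
  have hn : (n : ℂ) ≠ 0 := Nat.cast_ne_zero.2 (NeZero.ne n)
  ext k l
  simp only [Matrix.sum_apply, Matrix.vecMulVec_apply, Pi.star_apply, twistedFourier_mul_star]
  rw [← Finset.sum_div, ← Finset.mul_sum, sum_fourierEntry_mul_star, Matrix.one_apply]
  split_ifs with h
  · subst h
    rcases Int.units_eq_one_or (x k) with h | h <;> simp [h, hn]
  · simp

theorem sum_vecMulVec_star_twistedFourier {n : ℕ} [NeZero n] (x : Fin n → ℤˣ) :
    ∑ j, Matrix.vecMulVec (star (twistedFourier x j)) (twistedFourier x j) = 1 := by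
  rw [← Matrix.transpose_one, ← sum_vecMulVec_twistedFourier x, Matrix.transpose_sum]
  simp only [Matrix.transpose_vecMulVec]

theorem twistedFourier_orthogonal_of_ne {n : ℕ} [NeZero n] (x : Fin n → ℤˣ) {i j : Fin n}
    (h : i ≠ j) : twistedFourier x i ⬝ᵥ star (twistedFourier x j) = 0 := by
  simp only [dotProduct, Pi.star_apply, twistedFourier_mul_star]
  have hx : ∀ k, ((x k : ℤ) : ℂ) * ((x k : ℤ) : ℂ) = 1 := by
    intro k
    rcases Int.units_eq_one_or (x k) with h | h <;> simp [h]
  simp_rw [hx, one_mul, ← Finset.sum_div, fourierEntry_comm i, fourierEntry_comm j,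
    sum_fourierEntry_mul_star, if_neg h, zero_div]

theorem twistedFourier_orthogonal_of_adj {n : ℕ} [NeZero n] {x y : Fin n → ℤˣ}
    (h : (orthogonalityGraph n).Adj x y) (j : Fin n) :
    twistedFourier x j ⬝ᵥ star (twistedFourier y j) = 0 := by
  simp only [dotProduct, Pi.star_apply, twistedFourier_mul_star]
  have hf : ∀ k, fourierEntry n j k * star (fourierEntry n j k) = 1 := by
    intro k
    rw [fourierEntry, ← starRingEnd_apply, ← AddChar.map_neg_eq_conj, ← AddChar.map_add_eq_mul,
      add_neg_cancel, AddChar.map_zero_eq_one]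
  have h2 : ∑ k, ((x k : ℤ) : ℂ) * ((y k : ℤ) : ℂ) = 0 := by
    exact_mod_cast congrArg (Int.cast : ℤ → ℂ) h.2
  simp_rw [hf, mul_one, ← Finset.sum_div, h2, zero_div]

/-- The maximally entangled state. -/
noncomputable def maximallyEntangled (n : ℕ) : EuclideanSpace ℂ (Fin n × Fin n) :=
  WithLp.toLp 2 fun p => if p.1 = p.2 then ((Real.sqrt n : ℂ))⁻¹ else 0

theorem norm_maximallyEntangled (n : ℕ) [NeZero n] : ‖maximallyEntangled n‖ = 1 := by
  have hn : (n : ℝ) ≠ 0 := Nat.cast_ne_zero.2 (NeZero.ne n)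
  rw [EuclideanSpace.norm_eq, Real.sqrt_eq_one, Fintype.sum_prod_type]
  simp [maximallyEntangled, apply_ite, hn]

/-- The quantum colouring of the orthogonality graph by Fourier measurements. -/
noncomputable def fourierStrategy (n : ℕ) [NeZero n] :
    QuantumStrategy (Fin n → ℤˣ) (Fin n) where
  dA := n
  dB := n
  state := maximallyEntangled n
  norm_state := norm_maximallyEntangled n
  alice x j := Matrix.vecMulVec (twistedFourier x j) (star (twistedFourier x j))
  bob x j := Matrix.vecMulVec (star (twistedFourier x j)) (twistedFourier x j)
  alice_povm x := ⟨fun _ => Matrix.posSemidef_vecMulVec_self_star _,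
    sum_vecMulVec_twistedFourier x⟩
  bob_povm x := ⟨fun _ => Matrix.posSemidef_vecMulVec_star_self _,
    sum_vecMulVec_star_twistedFourier x⟩

/-- Both effects have rank one, and Bob's is conjugated so that pairing the entangled state with `u
⊗ star v` yields a multiple of `u ⬝ᵥ star v`. -/
theorem fourierStrategy_prob_eq_zero {n : ℕ} [NeZero n] {x x' : Fin n → ℤˣ} {j j' : Fin n}
    (h : twistedFourier x j ⬝ᵥ star (twistedFourier x' j') = 0) :
    (fourierStrategy n).prob x x' j j' = 0 := by
  have h1 : (Matrix.vecMulVec (twistedFourier x j) (star (twistedFourier x j)) ⊗ₖ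
      Matrix.vecMulVec (star (twistedFourier x' j')) (twistedFourier x' j')) =
      Matrix.vecMulVec
        (fun p : Fin n × Fin n => twistedFourier x j p.1 * star (twistedFourier x' j' p.2))
        (fun p => star (twistedFourier x j p.1) * twistedFourier x' j' p.2) := by
    ext p q
    simp only [Matrix.kroneckerMap_apply, Matrix.vecMulVec_apply, Pi.star_apply]
    ring
  have h2 : star (maximallyEntangled n).ofLp ⬝ᵥ
      (fun p : Fin n × Fin n => twistedFourier x j p.1 * star (twistedFourier x' j' p.2)) = 0 := by
    have : star (maximallyEntangled n).ofLp ⬝ᵥ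
        (fun p : Fin n × Fin n => twistedFourier x j p.1 * star (twistedFourier x' j' p.2))
        = star ((Real.sqrt n : ℂ))⁻¹ * (twistedFourier x j ⬝ᵥ star (twistedFourier x' j')) := by
      simp only [dotProduct, Fintype.sum_prod_type, maximallyEntangled, Pi.star_apply,
        apply_ite star, star_zero, ite_mul, zero_mul, Finset.sum_ite_eq, Finset.mem_univ, if_true, Finset.mul_sum]
    rw [this, h, mul_zero]
  change star (maximallyEntangled n).ofLp ⬝ᵥ
    ((Matrix.vecMulVec (twistedFourier x j) (star (twistedFourier x j)) ⊗ₖ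
      Matrix.vecMulVec (star (twistedFourier x' j')) (twistedFourier x' j')) *ᵥ
      (maximallyEntangled n).ofLp) = 0
  rw [h1, Matrix.dotProduct_mulVec, Matrix.vecMul_vecMulVec, h2, zero_smul, zero_dotProduct]

theorem fourierStrategy_wins (n : ℕ) [NeZero n] :
    (fourierStrategy n).Wins (orthogonalityGraph n) ⊤ := by
  refine ⟨fun x y y' hy => fourierStrategy_prob_eq_zero (twistedFourier_orthogonal_of_ne x hy),
    fun x x' y y' hx hy => ?_⟩
  obtain rfl : y = y' := by simpa using hy
  exact fourierStrategy_prob_eq_zero (twistedFourier_orthogonal_of_adj hx y)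

theorem mainTheorem3 (n : ℕ) (hn : 0 < n) (h4 : 4 ∣ n) :
    quantumChromaticNumber (orthogonalityGraph n) = n := by
  have : NeZero n := ⟨hn.ne'⟩
  have h : IsLeast {c : ℕ | QuantumHom (orthogonalityGraph n) (⊤ : SimpleGraph (Fin c))} n :=
    ⟨⟨fourierStrategy n, fourierStrategy_wins n⟩, fun _ hc => le_of_quantumHom_top hn h4 hc⟩
  exact h.csInf_eq
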